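/- Let $\mathbb{B}^n$ be the closed Euclidean unit ball of $\mathbb{R}^n$, let $L_1, L_2 \subseteq \mathbb{R}^n$ be convex bodies (compact convex sets with non-empty interior), let $c, d \in \mathbb{R}^n$, and let $r, R > 0$ be reals such that $r L_1 + c \subseteq \mathbb{B}^n \subseteq R L_2 + d$. Write $\operatorname{bd}$ for the boundary of a set. The chain $r L_1 + c \subseteq \mathbb{B}^n \subseteq R L_2 + d$ is called affinely-optimal if $\frac{R'}{r'} \geq \frac{R}{r}$ for every linear operator $T$ on $\mathbb{R}^n$, all vectors $c', d' \in \mathbb{R}^n$, and all reals $r', R' > 0$ with $r' L_1 + c' \subseteq T(\mathbb{B}^n) \subseteq R' L_2 + d'$. Then the following conditions are equivalent: 1. The chain $r L_1 + c \subseteq \mathbb{B}^n \subseteq R L_2 + d$ is affinely-optimal. 2. For every real symmetric $n \times n$ matrix $A$ and all vectors $v, w \in \mathbb{R}^n$, there exist $y \in \operatorname{bd}(\mathbb{B}^n) \cap \operatorname{bd}(r L_1 + c)$ and $z \in \operatorname{bd}(\mathbb{B}^n) \cap \operatorname{bd}(R L_2 + d)$ such that $\langle y, A y + v \rangle \leq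 \langle z, A z + w \rangle$. 3. There exist integers $N, M \geq 1$, points $y^1, \ldots, y^N \in \operatorname{bd}(\mathbb{B}^n) \cap \operatorname{bd}(r L_1 + c)$ and $z^1, \ldots, z^M \in \operatorname{bd}(\mathbb{B}^n) \cap \operatorname{bd}(R L_2 + d)$, and weights $\lambda_1, \ldots, \lambda_N, \mu_1, \ldots, \mu_M > 0$ such that $$\sum_{i=1}^N \lambda_i \langle x, y^i \rangle y^i = \sum_{j=1}^M \mu_j \langle x, z^j \rangle z^j \quad \text{for all } x \in \mathbb{R}^n, \qquad \text{and} \qquad \sum_{i=1}^N \lambda_i y^i = \sum_{j=1}^M \mu_j z^j = 0.$$ Moreover, every decomposition as in 3 satisfies $\sum_{i=1}^N \lambda_i = \sum_{j=1}^M \mu_j$, and if the equivalent conditions hold, then there exists a decomposition as in 3 with $N + M \leq \frac{n(n+5)}{2} + 1$. -/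

import Mathlib

open scoped Pointwise

/-- The containment chain `r L₁ + c ⊆ K ⊆ R L₂ + d` in `ℝⁿ`. -/
def IsContainmentChain {n : ℕ} (L₁ K L₂ : Set (EuclideanSpace ℝ (Fin n)))
    (r : ℝ) (c : EuclideanSpace ℝ (Fin n)) (R : ℝ) (d : EuclideanSpace ℝ (Fin n)) : Prop :=
  r • L₁ + {c} ⊆ K ∧ K ⊆ R • L₂ + {d}

/-- The containment chain `r L₁ + c ⊆ K ⊆ R L₂ + d` is affinely-optimal: it holds, and no linear
image `T(K)` of `K` fits into a chain `r' L₁ + c' ⊆ T(K) ⊆ R' L₂ + d'` with a ratio `R' / r'`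
smaller than `R / r`. The operator `T` is not required to be invertible. -/
def IsAffinelyOptimal {n : ℕ} (L₁ K L₂ : Set (EuclideanSpace ℝ (Fin n)))
    (r : ℝ) (c : EuclideanSpace ℝ (Fin n)) (R : ℝ) (d : EuclideanSpace ℝ (Fin n)) : Prop :=
  IsContainmentChain L₁ K L₂ r c R d ∧
    ∀ (T : EuclideanSpace ℝ (Fin n) →ₗ[ℝ] EuclideanSpace ℝ (Fin n))
      (c' d' : EuclideanSpace ℝ (Fin n)) (r' R' : ℝ), 0 < r' → 0 < R' →
      IsContainmentChain L₁ (T '' K) L₂ r' c' R' d' → R / r ≤ R' / r'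

/-- Points `y¹, …, yᴺ ∈ Y` and `z¹, …, zᴹ ∈ Z` (with `N, M ≥ 1`) and positive weights
`lam` and `mu` form a centered Ader decomposition:
`∑ lamᵢ ⟨x, yⁱ⟩ yⁱ = ∑ muⱼ ⟨x, zʲ⟩ zʲ` for all `x`, and `∑ lamᵢ yⁱ = ∑ muⱼ zʲ = 0`. -/
structure IsAderDecomposition {n : ℕ} (Y Z : Set (EuclideanSpace ℝ (Fin n))) {N M : ℕ}
    (y : Fin N → EuclideanSpace ℝ (Fin n)) (lam : Fin N → ℝ)
    (z : Fin M → EuclideanSpace ℝ (Fin n)) (mu : Fin M → ℝ) : Prop where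
  one_le_left : 1 ≤ N
  one_le_right : 1 ≤ M
  mem_left : ∀ i, y i ∈ Y
  mem_right : ∀ j, z j ∈ Z
  pos_left : ∀ i, 0 < lam i
  pos_right : ∀ j, 0 < mu j
  sum_inner_smul_eq : ∀ x : EuclideanSpace ℝ (Fin n),
    ∑ i, (lam i * inner ℝ x (y i)) • y i = ∑ j, (mu j * inner ℝ x (z j)) • z j
  sum_left_eq_zero : ∑ i, lam i • y i = 0
  sum_right_eq_zero : ∑ j, mu j • z j = 0

/-- The contact points (common boundary points) of two sets in `ℝⁿ`. -/
def contactPoints {n : ℕ} (K L : Set (EuclideanSpace ℝ (Fin n))) :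
    Set (EuclideanSpace ℝ (Fin n)) :=
  frontier K ∩ frontier L

/-!
Write `B` for the unit ball, `P = r L₁ + c ⊆ B ⊆ Q = R L₂ + d`, and `Y`, `Z` for the inner and outer
contact points. Then `Y` consists of the unit vectors lying in `P`, and `Z` of the unit vectors `z`
with `⟪z, q⟫ ≤ 1` on all of `Q`.

Optimality implies the quadratic condition by contraposition. If `⟪y, A y + v⟫ > ⟪z, A z + w⟫` for
all contact points, compactness lets one subtract a multiple of the identity from `A` so that the
left side is positive and the right side negative. To first order in `ε` the ellipsoid
`(1 + ε A) B + ε v` then grows beyond `P` at `Y`, and `(1 + ε A) B + ε w` retreats into `Q` at `Z`,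
which gives a better ratio (`exists_ellipsoid_chain_of_quadratic_separation`).

The quadratic condition says that no linear functional is positive on all points `(y yᵀ, y, 0)` and
`(-z zᵀ, 0, -z)` with `y ∈ Y`, `z ∈ Z`, in a space of dimension `n (n + 5) / 2`. By separation, `0`
lies in their (compact) convex hull (`zero_mem_convexHull_moments`), and Carathéodory's theorem turns
this into a decomposition with at most `n (n + 5) / 2 + 1` points.

A decomposition implies optimality by a trace argument
(`IsAderDecomposition.isAffinelyOptimal`). An ellipsoid `T(B)` equals `S(B)` with
`S = √(T T*)` positive, and `∑ lamᵢ ⟪yⁱ, S yⁱ⟫ = ∑ muⱼ ⟪zʲ, S zʲ⟫`. The inclusion of `r' L₁ + c'`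
bounds this number below by `(r' / r) ∑ lamᵢ`, the inclusion in `R' L₂ + d'` bounds it above by
`(R' / R) ∑ muⱼ`, and the two total weights agree (take `S = id`).
-/

/-! ### Compactness -/

/-- By Carathéodory's theorem the convex hull is the image of the compact set `Δ × s ^ D`,
where `D` is one more than the dimension and `Δ` the standard simplex in `ℝ ^ D`, under `(w, p) ↦ ∑ i, w i • p i`. -/
theorem IsCompact.convexHull_of_finiteDimensional {V : Type*} [NormedAddCommGroup V]
    [NormedSpace ℝ V] [FiniteDimensional ℝ V] {s : Set V} (hs : IsCompact s) :
    IsCompact (convexHull ℝ s) := by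
  classical
  rcases s.eq_empty_or_nonempty with rfl | ⟨p₀, hp₀⟩
  · simp
  set D := Module.finrank ℝ V + 1
  have key : convexHull ℝ s = (fun p : (Fin D → ℝ) × (Fin D → V) => ∑ i, p.1 i • p.2 i) ''
      (stdSimplex ℝ (Fin D) ×ˢ Set.univ.pi fun _ => s) := by
    apply Set.Subset.antisymm
    · intro x hx
      obtain ⟨ι, _, z, w, hz, hind, hw, hw1, hsum⟩ := eq_pos_convex_span_of_mem_convexHull hx
      have hcard : Fintype.card ι ≤ Fintype.card (Fin D) := by
        rw [Fintype.card_fin]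
        exact hind.card_le_finrank_succ.trans (Nat.succ_le_succ (Submodule.finrank_le _))
      obtain ⟨e⟩ := Function.Embedding.nonempty_of_card_le hcard
      refine ⟨(Function.extend e w 0, Function.extend e z fun _ => p₀), ⟨⟨?_, ?_⟩, ?_⟩, ?_⟩
      · intro i
        by_cases hi : ∃ a, e a = i
        · obtain ⟨a, rfl⟩ := hi
          simpa [e.injective.extend_apply] using (hw a).le
        · simp [Function.extend_apply' _ _ _ hi]
      · rw [← hw1]
        refine (Fintype.sum_of_injective e e.injective _ _ ?_ ?_).symm
        · intro i hi
          exact Function.extend_apply' _ _ _ hi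
        · intro a
          simp [e.injective.extend_apply]
      · intro i _
        by_cases hi : ∃ a, e a = i
        · obtain ⟨a, rfl⟩ := hi
          simpa [e.injective.extend_apply] using hz ⟨a, rfl⟩
        · simpa [Function.extend_apply' _ _ _ hi] using hp₀
      · rw [← hsum]
        refine (Fintype.sum_of_injective e e.injective _ _ ?_ ?_).symm
        · intro i hi
          simp [Function.extend_apply' _ _ _ hi]
        · intro a
          simp [e.injective.extend_apply]
    · rintro _ ⟨p, ⟨⟨h0, h1⟩, hp⟩, rfl⟩
      exact (convex_convexHull ℝ s).sum_mem (fun i _ => h0 i) h1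
        fun i _ => subset_convexHull ℝ s (hp i trivial)
  rw [key]
  refine ((isCompact_stdSimplex ℝ (Fin D)).prod (isCompact_univ_pi fun _ => hs)).image ?_
  fun_prop

/-- If `g` on `Z` is strictly below `f` on `Y`, some real number separates the values strictly.
Either set may be empty. -/
theorem IsCompact.exists_forall_between {X : Type*} [TopologicalSpace X] {Y Z : Set X}
    (hY : IsCompact Y) (hZ : IsCompact Z) {f g : X → ℝ} (hf : Continuous f) (hg : Continuous g)
    (h : ∀ y ∈ Y, ∀ z ∈ Z, g z < f y) : ∃ a : ℝ, (∀ y ∈ Y, a < f y) ∧ ∀ z ∈ Z, g z < a := by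
  rcases Y.eq_empty_or_nonempty with rfl | hYne
  · obtain ⟨b, hb⟩ := (hZ.image hg).bddAbove
    exact ⟨b + 1, by simp, fun z hz => (hb ⟨z, hz, rfl⟩).trans_lt (lt_add_one b)⟩
  obtain ⟨y, hy, hmin⟩ := hY.exists_isMinOn hYne hf.continuousOn
  rcases Z.eq_empty_or_nonempty with rfl | hZne
  · exact ⟨f y - 1, fun y' hy' => (sub_one_lt _).trans_le (hmin hy'), by simp⟩
  obtain ⟨z, hz, hmax⟩ := hZ.exists_isMaxOn hZne hg.continuousOn
  obtain ⟨a, ha, ha'⟩ := exists_between (h y hy z hz)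
  exact ⟨a, fun y' hy' => ha'.trans_le (hmin hy'), fun z' hz' => (hmax hz').trans_lt ha⟩

/-- First-order perturbation on a compact set: if `F ≥ 0` and `G > 0` on the zero set of `F`, then
`F + ε G` is bounded below by a positive multiple of `ε` for all small `ε > 0`. -/
theorem IsCompact.exists_forall_mul_le_add_mul {X : Type*} [TopologicalSpace X] {K : Set X}
    (hK : IsCompact K) {F G : X → ℝ} (hF : Continuous F) (hG : Continuous G)
    (hF0 : ∀ p ∈ K, 0 ≤ F p) (hG0 : ∀ p ∈ K, F p = 0 → 0 < G p) :
    ∃ η > 0, ∃ ε₀ > 0, ∀ ε, 0 < ε → ε ≤ ε₀ → ∀ p ∈ K, ε * η ≤ F p + ε * G p := by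
  -- `G` has a positive lower bound `a` on the compact zero set of `F` in `K`.
  obtain ⟨a, ha, ha'⟩ : ∃ a : ℝ, (∀ p ∈ K ∩ F ⁻¹' {0}, a < G p) ∧ 0 < a := by
    obtain ⟨a, h1, h2⟩ := IsCompact.exists_forall_between
      (hK.inter_right (isClosed_singleton.preimage hF)) (Z := K ∩ F ⁻¹' {0})
      (hK.inter_right (isClosed_singleton.preimage hF)) hG continuous_zero
      (fun y hy _ _ => hG0 y hy.1 hy.2)
    rcases (K ∩ F ⁻¹' {0}).eq_empty_or_nonempty with h | ⟨z, hz⟩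
    · exact ⟨1, by simp [h], one_pos⟩
    · exact ⟨a, h1, h2 z hz⟩
  -- Where `G ≤ a`, the function `F` has a positive lower bound.
  have hcpt : IsCompact (K ∩ {p | G p ≤ a}) := hK.inter_right (isClosed_le hG continuous_const)
  obtain ⟨m, hm, hm'⟩ : ∃ m : ℝ, (∀ p ∈ K ∩ {p | G p ≤ a}, m ≤ F p) ∧ 0 < m := by
    rcases (K ∩ {p | G p ≤ a}).eq_empty_or_nonempty with h | h
    · exact ⟨1, by simp [h], one_pos⟩
    · obtain ⟨p, hp, hmin⟩ := hcpt.exists_isMinOn h hF.continuousOn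
      refine ⟨F p, fun q hq => hmin hq, (hF0 p hp.1).lt_of_ne' fun h0 => ?_⟩
      exact absurd (ha p ⟨hp.1, h0⟩) (not_lt.2 hp.2)
  obtain ⟨b, hb⟩ := (hK.image hG).bddBelow
  refine ⟨a, ha', m / (|a - b| + 1), by positivity, fun ε hε hε' p hp => ?_⟩
  rcases le_or_gt (G p) a with h | h
  · have h1 := hm p ⟨hp, h⟩
    have h2 : b ≤ G p := hb ⟨p, hp, rfl⟩
    rw [le_div_iff₀ (by positivity)] at hε'
    have h3 : ε * (a - G p) ≤ ε * (|a - b| + 1) :=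
      mul_le_mul_of_nonneg_left (by linarith [le_abs_self (a - b)]) hε.le
    linarith
  · have := mul_le_mul_of_nonneg_left h.le hε.le
    linarith [hF0 p hp]

/-! ### Ellipsoids and support functions -/

section InnerProduct

variable {E : Type*} [NormedAddCommGroup E] [InnerProductSpace ℝ E]

local notation "⟪" x ", " y "⟫" => inner ℝ x y

/-- A closed convex set contains `x` once no unit vector separates them. Nonemptiness matters only
in the zero space, which has no unit vectors. -/
theorem Convex.mem_of_forall_inner_le [CompleteSpace E] {C : Set E} (hC : Convex ℝ C)
    (hCc : IsClosed C) (hne : C.Nonempty) {x : E}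
    (h : ∀ u : E, ‖u‖ = 1 → ∃ q ∈ C, ⟪u, x⟫ ≤ ⟪u, q⟫) : x ∈ C := by
  by_contra hx
  obtain ⟨f, b, hf, hb⟩ := geometric_hahn_banach_closed_point hC hCc hx
  obtain ⟨a, rfl⟩ := (InnerProductSpace.toDual ℝ E).surjective f
  simp only [InnerProductSpace.toDual_apply_apply] at hf hb
  have ha : a ≠ 0 := by
    rintro rfl
    obtain ⟨q, hq⟩ := hne
    have := hf q hq
    simp only [inner_zero_left] at this hb
    linarith
  have hn : 0 < ‖a‖ := norm_pos_iff.2 ha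
  obtain ⟨q, hq, hle⟩ := h (‖a‖⁻¹ • a) (by simp [norm_smul, hn.ne'])
  rw [real_inner_smul_left, real_inner_smul_left] at hle
  have := le_of_mul_le_mul_left hle (inv_pos.2 hn)
  linarith [hf q hq]

variable [FiniteDimensional ℝ E]

/-- The image of the unit ball under `T` is compact and convex with support function
`u ↦ ‖T* u‖`, so it contains every point below that function. -/
theorem mem_image_closedBall_of_forall_inner_le (T : E →ₗ[ℝ] E) {x : E}
    (h : ∀ u : E, ‖u‖ = 1 → ⟪u, x⟫ ≤ ‖T.adjoint u‖) : x ∈ T '' Metric.closedBall 0 1 := by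
  have hT : Continuous T := T.continuous_of_finiteDimensional
  refine Convex.mem_of_forall_inner_le ((convex_closedBall _ _).linear_image T)
    ((isCompact_closedBall _ _).image hT).isClosed ⟨_, 0, by simp, rfl⟩ fun u hu => ?_
  refine ⟨_, ⟨‖T.adjoint u‖⁻¹ • T.adjoint u, ?_, rfl⟩, (h u hu).trans ?_⟩
  · rw [mem_closedBall_zero_iff, norm_smul, norm_inv, norm_norm]
    exact inv_mul_le_one
  · rw [map_smul, real_inner_smul_right, ← LinearMap.adjoint_inner_left,
      real_inner_self_eq_norm_sq]
    rcases eq_or_ne ‖T.adjoint u‖ 0 with h0 | h0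
    · simp [h0]
    · exact le_of_eq (by field_simp)

theorem image_closedBall_subset_of_norm_adjoint_le {S T : E →ₗ[ℝ] E}
    (h : ∀ u, ‖S.adjoint u‖ ≤ ‖T.adjoint u‖) :
    S '' Metric.closedBall 0 1 ⊆ T '' Metric.closedBall 0 1 := by
  rintro _ ⟨b, hb, rfl⟩
  rw [mem_closedBall_zero_iff] at hb
  refine mem_image_closedBall_of_forall_inner_le T fun u _ => ?_
  rw [← LinearMap.adjoint_inner_left]
  calc ⟪S.adjoint u, b⟫ ≤ ‖S.adjoint u‖ * ‖b‖ := real_inner_le_norm _ _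
    _ ≤ ‖S.adjoint u‖ * 1 := by gcongr
    _ ≤ ‖T.adjoint u‖ := by rw [mul_one]; exact h u

/-- Polar decomposition without the unitary factor: `S` is the positive square root of `T T*`,
built from an orthonormal eigenbasis. -/
theorem LinearMap.exists_isPositive_norm_eq_norm_adjoint (T : E →ₗ[ℝ] E) :
    ∃ S : E →ₗ[ℝ] E, S.IsPositive ∧ ∀ x, ‖S x‖ = ‖T.adjoint x‖ := by
  have hP : (T ∘ₗ T.adjoint).IsPositive := LinearMap.isPositive_self_comp_adjoint T
  have hsym := hP.isSymmetric
  set b := hsym.eigenvectorBasis rfl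
  set l := hsym.eigenvalues rfl
  have hl0 : ∀ i, 0 ≤ l i := fun i => hP.nonneg_eigenvalues rfl i
  let S : E →ₗ[ℝ] E := ∑ i, √(l i) • (innerₛₗ ℝ (b i)).smulRight (b i)
  have hS : ∀ x, S x = ∑ i, (√(l i) * ⟪b i, x⟫) • b i := fun x => by
    simp [S, LinearMap.sum_apply, smul_smul]
  have hin : ∀ x y, ⟪S x, y⟫ = ∑ i, √(l i) * (⟪b i, x⟫ * ⟪b i, y⟫) := fun x y => by
    rw [hS, sum_inner]
    exact Finset.sum_congr rfl fun i _ => by rw [real_inner_smul_left]; ring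
  refine ⟨S, ⟨fun x y => ?_, fun x => ?_⟩, fun x => ?_⟩
  · rw [hin, real_inner_comm, hin]
    exact Finset.sum_congr rfl fun i _ => by ring
  · simp only [RCLike.re_to_real]
    rw [hin]
    exact Finset.sum_nonneg fun i _ => mul_nonneg (Real.sqrt_nonneg _) (mul_self_nonneg _)
  · have hbS : ∀ i, ⟪b i, S x⟫ = √(l i) * ⟪b i, x⟫ := fun i => by
      rw [hS, b.orthonormal.inner_right_fintype]
    have h1 : ‖S x‖ ^ 2 = ∑ i, l i * (⟪b i, x⟫ * ⟪b i, x⟫) := by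
      rw [← real_inner_self_eq_norm_sq, hin]
      refine Finset.sum_congr rfl fun i _ => ?_
      rw [hbS]
      nlinarith [Real.mul_self_sqrt (hl0 i)]
    have h2 : ‖T.adjoint x‖ ^ 2 = ∑ i, l i * (⟪b i, x⟫ * ⟪b i, x⟫) := by
      rw [← real_inner_self_eq_norm_sq, LinearMap.adjoint_inner_left,
        ← b.sum_inner_mul_inner]
      refine Finset.sum_congr rfl fun i _ => ?_
      have := hsym (b i) x
      rw [hsym.apply_eigenvectorBasis rfl i] at this
      change ⟪l i • b i, x⟫ = ⟪b i, T (T.adjoint x)⟫ at this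
      rw [real_inner_comm (b i) x, ← this, real_inner_smul_left]
      ring
    exact (pow_left_inj₀ (norm_nonneg _) (norm_nonneg _) two_ne_zero).1 (h1.trans h2.symm)

end InnerProduct

/-! ### Contact points -/

theorem Set.mem_smul_set_add_singleton {V : Type*} [AddCommGroup V] [Module ℝ V] {L : Set V}
    {r : ℝ} {c x : V} : x ∈ r • L + {c} ↔ ∃ l ∈ L, r • l + c = x := by
  simp [Set.mem_smul_set, ← sub_eq_add_neg, eq_sub_iff_add_eq]

section Contact
variable {n : ℕ}
local notation "⟪" x ", " y "⟫" => inner ℝ x y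

theorem mem_contactPoints_of_subset_closedBall {P : Set (EuclideanSpace ℝ (Fin n))}
    (hP : IsClosed P) (h : P ⊆ Metric.closedBall 0 1) {y : EuclideanSpace ℝ (Fin n)} :
    y ∈ contactPoints (Metric.closedBall 0 1) P ↔ ‖y‖ = 1 ∧ y ∈ P := by
  rw [contactPoints, frontier_closedBall _ one_ne_zero, Set.mem_inter_iff,
    mem_sphere_zero_iff_norm, hP.frontier_eq]
  refine and_congr_right fun hy => ⟨fun h => h.1, fun hyP => ⟨hyP, fun hi => ?_⟩⟩
  have := interior_mono h hi
  rw [interior_closedBall _ one_ne_zero, mem_ball_zero_iff] at this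
  exact this.ne hy

/-- At an outer contact point `z`, a supporting hyperplane of `Q` also supports the ball, hence is
the tangent hyperplane `⟪z, ·⟫ = 1`. -/
theorem mem_contactPoints_of_closedBall_subset {Q : Set (EuclideanSpace ℝ (Fin n))}
    (hQ : Convex ℝ Q) (hQc : IsClosed Q) (h : Metric.closedBall 0 1 ⊆ Q)
    {z : EuclideanSpace ℝ (Fin n)} :
    z ∈ contactPoints (Metric.closedBall 0 1) Q ↔ ‖z‖ = 1 ∧ ∀ q ∈ Q, ⟪z, q⟫ ≤ 1 := by
  rw [contactPoints, frontier_closedBall _ one_ne_zero, Set.mem_inter_iff,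
    mem_sphere_zero_iff_norm, hQc.frontier_eq]
  refine and_congr_right fun hz =>
    ⟨fun hzQ q hq => ?_, fun hzQ => ⟨h (by simp [hz]), fun hi => ?_⟩⟩
  · obtain ⟨f, hf⟩ := geometric_hahn_banach_open_point hQ.interior isOpen_interior hzQ.2
    obtain ⟨a, rfl⟩ := (InnerProductSpace.toDual ℝ _).surjective f
    simp only [InnerProductSpace.toDual_apply_apply] at hf
    have hne : (interior Q).Nonempty :=
      ⟨0, interior_mono h (by rw [interior_closedBall _ one_ne_zero]; simp)⟩
    -- A convex set with interior points lies in the closure of its interior.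
    have hf' : ∀ q ∈ Q, ⟪a, q⟫ ≤ ⟪a, z⟫ := fun q hq => by
      have hq' : q ∈ closure (interior Q) := by
        rw [hQ.closure_interior_eq_closure_of_nonempty_interior hne]
        exact subset_closure hq
      have hcl : IsClosed {p | ⟪a, p⟫ ≤ ⟪a, z⟫} := isClosed_le (by fun_prop) continuous_const
      exact closure_minimal (fun p hp => (hf p hp).le) hcl hq'
    have ha : a ≠ 0 := by
      rintro rfl
      obtain ⟨p, hp⟩ := hne
      simpa using hf p hp
    have hn : 0 < ‖a‖ := norm_pos_iff.2 ha
    -- `a` attains its norm on the unit ball at `z`, so `a = ‖a‖ • z`.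
    have h1 : ‖a‖ ≤ ⟪a, z⟫ := by
      refine le_of_eq_of_le ?_ (hf' (‖a‖⁻¹ • a) (h (by simp [norm_smul, hn.ne'])))
      rw [real_inner_smul_right, real_inner_self_eq_norm_sq]
      field_simp
    have h2 : ⟪a, z⟫ = ‖a‖ * ‖z‖ :=
      le_antisymm (real_inner_le_norm a z) (by rw [hz, mul_one]; exact h1)
    have h3 : a = ‖a‖ • z := by
      have := inner_eq_norm_mul_iff_real.1 h2
      rwa [hz, one_smul] at this
    have h4 := hf' q hq
    have h5 : ⟪a, q⟫ = ‖a‖ * ⟪z, q⟫ := by conv_lhs => rw [h3, real_inner_smul_left]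
    rw [h2, hz, mul_one, h5] at h4
    exact le_of_mul_le_mul_left (by linarith) hn
  -- An interior point `z` of `Q` could be pushed outwards to `(1 + t) • z`.
  · have hz2 : ⟪z, z⟫ = 1 := by rw [real_inner_self_eq_norm_sq, hz, one_pow]
    have hc : Continuous fun t : ℝ => (1 + t) • z := by fun_prop
    have hev : ∀ᶠ t in nhds (0 : ℝ), (1 + t) • z ∈ interior Q :=
      hc.continuousAt.eventually_mem (isOpen_interior.mem_nhds (by simpa using hi))
    obtain ⟨t, ht, ht0⟩ := ((hev.filter_mono nhdsWithin_le_nhds).and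
      (self_mem_nhdsWithin (s := Set.Ioi (0 : ℝ)))).exists
    have := hzQ _ (interior_subset ht)
    rw [real_inner_smul_right, hz2] at this
    have ht0' : 0 < t := ht0
    linarith

theorem isCompact_contactPoints_closedBall (Q : Set (EuclideanSpace ℝ (Fin n))) :
    IsCompact (contactPoints (Metric.closedBall 0 1) Q) := by
  rw [contactPoints, frontier_closedBall _ one_ne_zero]
  exact (isCompact_sphere _ _).inter_right isClosed_frontier

end Contact

/-! ### Decompositions imply optimality -/

section Ader
variable {n : ℕ} {Y Z : Set (EuclideanSpace ℝ (Fin n))} {N M : ℕ}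
  {y : Fin N → EuclideanSpace ℝ (Fin n)} {lam : Fin N → ℝ}
  {z : Fin M → EuclideanSpace ℝ (Fin n)} {mu : Fin M → ℝ}

local notation "⟪" x ", " y "⟫" => inner ℝ x y

/-- Both families represent the same operator `∑ lamᵢ yⁱ ⊗ yⁱ = ∑ muⱼ zʲ ⊗ zʲ`; the two sides are
the trace of its composition with `S`. -/
theorem IsAderDecomposition.sum_inner_map_eq (h : IsAderDecomposition Y Z y lam z mu)
    (S : EuclideanSpace ℝ (Fin n) →ₗ[ℝ] EuclideanSpace ℝ (Fin n)) :
    ∑ i, lam i * ⟪y i, S (y i)⟫ = ∑ j, mu j * ⟪z j, S (z j)⟫ := by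
  set e := EuclideanSpace.basisFun (Fin n) ℝ
  have key : ∀ (K : ℕ) (p : Fin K → EuclideanSpace ℝ (Fin n)) (a : Fin K → ℝ),
      ∑ i, a i * ⟪p i, S (p i)⟫ = ∑ k, ⟪∑ i, (a i * ⟪S.adjoint (e k), p i⟫) • p i, e k⟫ := by
    intro K p a
    simp only [sum_inner]
    rw [Finset.sum_comm]
    refine Finset.sum_congr rfl fun i _ => ?_
    rw [← e.sum_inner_mul_inner, Finset.mul_sum]
    refine Finset.sum_congr rfl fun k _ => ?_
    rw [real_inner_smul_left, LinearMap.adjoint_inner_left]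
    ring
  rw [key, key]
  exact Finset.sum_congr rfl fun k _ => by rw [h.sum_inner_smul_eq]

theorem IsAderDecomposition.sum_eq_sum (h : IsAderDecomposition Y Z y lam z mu)
    (hY : ∀ y ∈ Y, ‖y‖ = 1) (hZ : ∀ z ∈ Z, ‖z‖ = 1) : ∑ i, lam i = ∑ j, mu j := by
  have := h.sum_inner_map_eq LinearMap.id
  simpa [real_inner_self_eq_norm_sq, hY _ (h.mem_left _), hZ _ (h.mem_right _)] using this

/-- For `r' L₁ + c' ⊆ T(B) ⊆ R' L₂ + d'`, replace `T` by the positive operator `S` with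
`S(B) = T(B)`. Averaging `⟪y, S y⟫` over the `yⁱ` bounds the trace of `S` against the decomposition
from below by `r' / r`, averaging `⟪z, S z⟫` over the `zʲ` bounds it from above by `R' / R`. -/
theorem IsAderDecomposition.isAffinelyOptimal {L₁ L₂ : Set (EuclideanSpace ℝ (Fin n))}
    {c d : EuclideanSpace ℝ (Fin n)} {r R : ℝ} (hr : 0 < r) (hR : 0 < R)
    (hchain : IsContainmentChain L₁ (Metric.closedBall 0 1) L₂ r c R d)
    (hY : ∀ y ∈ Y, ‖y‖ = 1 ∧ y ∈ r • L₁ + {c})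
    (hZ : ∀ z ∈ Z, ‖z‖ = 1 ∧ ∀ q ∈ R • L₂ + {d}, ⟪z, q⟫ ≤ 1)
    (h : IsAderDecomposition Y Z y lam z mu) :
    IsAffinelyOptimal L₁ (Metric.closedBall 0 1) L₂ r c R d := by
  refine ⟨hchain, fun T c' d' r' R' hr' hR' ⟨hin, hout⟩ => ?_⟩
  obtain ⟨S, hS, hST⟩ := T.exists_isPositive_norm_eq_norm_adjoint
  have hSadj : S.adjoint = S := (LinearMap.isSymmetric_iff_isSelfAdjoint S).1 hS.isSymmetric
  have hsub₁ := image_closedBall_subset_of_norm_adjoint_le (S := T) (T := S)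
    fun u => by rw [hSadj, hST]
  have hsub₂ := image_closedBall_subset_of_norm_adjoint_le (S := S) (T := T)
    fun u => by rw [hSadj, hST]
  have hW := h.sum_eq_sum (fun y hy => (hY y hy).1) fun z hz => (hZ z hz).1
  have hW0 : 0 < ∑ i, lam i := by
    have := h.one_le_left
    exact Finset.sum_pos (fun i _ => h.pos_left i) ⟨⟨0, this⟩, Finset.mem_univ _⟩
  set W := ∑ i, lam i
  -- The points `(r' / r) • y i + e` lie in `r' • L₁ + c'`, hence in the ellipsoid.
  set e := c' - (r' / r) • c with he
  have hx : ∀ i, ∃ x, ‖x‖ ≤ 1 ∧ S x = (r' / r) • y i + e := by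
    intro i
    obtain ⟨l, hl, hyl⟩ := Set.mem_smul_set_add_singleton.1 (hY _ (h.mem_left i)).2
    obtain ⟨x, hx, hxS⟩ := hsub₁ (hin (Set.mem_smul_set_add_singleton.2 ⟨l, hl, rfl⟩))
    refine ⟨x, mem_closedBall_zero_iff.1 hx, ?_⟩
    rw [hxS, ← hyl, he, smul_add, smul_smul, div_mul_cancel₀ _ hr.ne']
    abel
  choose x hx1 hxS using hx
  set u := W⁻¹ • ∑ i, lam i • x i with hu
  -- Since `∑ lamᵢ yⁱ = 0`, averaging the preimages `x i` gives a preimage of `e`.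
  have hSu : S u = e := by
    rw [hu, map_smul, map_sum]
    simp only [map_smul, hxS, smul_add, Finset.sum_add_distrib, smul_comm _ (r' / r)]
    rw [← Finset.smul_sum, h.sum_left_eq_zero, smul_zero, smul_zero, zero_add, ← Finset.sum_smul,
      inv_smul_smul₀ hW0.ne']
  have hleft : ∀ i, r' / r + r' / r * ⟪u, y i⟫ ≤ ⟪y i, S (y i)⟫ := by
    intro i
    have hyy : ⟪y i, y i⟫ = 1 := by
      rw [real_inner_self_eq_norm_sq, (hY _ (h.mem_left i)).1, one_pow]
    have hSp : S (x i - u) = (r' / r) • y i := by rw [map_sub, hxS, hSu, add_sub_cancel_right]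
    -- With `p = x i - u` and `S p = (r' / r) • y i`, the bound is `⟪S (y - p), y - p⟫ ≥ 0`
    -- expanded.
    have h0 : 0 ≤ ⟪S (y i - (x i - u)), y i - (x i - u)⟫ := hS.re_inner_nonneg_left _
    have hxy : ⟪y i, x i⟫ ≤ 1 := (real_inner_le_norm _ _).trans (by
      rw [(hY _ (h.mem_left i)).1, one_mul]; exact hx1 i)
    have hsymm : ⟪S (y i), x i - u⟫ = r' / r := by
      rw [hS.isSymmetric, hSp, real_inner_smul_right, hyy, mul_one]
    rw [map_sub, hSp, inner_sub_left, inner_sub_right (S (y i)), hsymm, real_inner_smul_left,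
      inner_sub_right, inner_sub_right, hyy] at h0
    rw [real_inner_comm (S (y i)), real_inner_comm (y i) u]
    have := mul_le_mul_of_nonneg_left hxy (div_pos hr' hr).le
    nlinarith
  have hright : ∀ j, ⟪z j, S (z j)⟫ ≤ R' / R + ⟪z j, d' - (R' / R) • d⟫ := by
    intro j
    have hz := hZ _ (h.mem_right j)
    obtain ⟨l, hl, hyl⟩ := Set.mem_smul_set_add_singleton.1
      (hout (hsub₂ ⟨z j, mem_closedBall_zero_iff.2 hz.1.le, rfl⟩))
    have hq := hz.2 (R • l + d) (Set.mem_smul_set_add_singleton.2 ⟨l, hl, rfl⟩)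
    have hdec : S (z j) = (R' / R) • (R • l + d) + (d' - (R' / R) • d) := by
      rw [← hyl, smul_add, smul_smul, div_mul_cancel₀ _ hR.ne']
      abel
    rw [hdec, inner_add_right, real_inner_smul_right]
    have := mul_le_mul_of_nonneg_left hq (div_pos hR' hR).le
    linarith
  have h1 : r' / r * W ≤ ∑ i, lam i * ⟪y i, S (y i)⟫ := by
    calc r' / r * W = r' / r * W + r' / r * ⟪u, ∑ i, lam i • y i⟫ := by
          rw [h.sum_left_eq_zero, inner_zero_right]; ring
      _ = ∑ i, lam i * (r' / r + r' / r * ⟪u, y i⟫) := by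
          simp only [inner_sum, real_inner_smul_right, W, Finset.mul_sum,
            ← Finset.sum_add_distrib]
          exact Finset.sum_congr rfl fun i _ => by ring
      _ ≤ _ := Finset.sum_le_sum fun i _ => mul_le_mul_of_nonneg_left (hleft i) (h.pos_left i).le
  have h2 : ∑ j, mu j * ⟪z j, S (z j)⟫ ≤ R' / R * W := by
    calc _ ≤ ∑ j, mu j * (R' / R + ⟪z j, d' - (R' / R) • d⟫) :=
          Finset.sum_le_sum fun j _ => mul_le_mul_of_nonneg_left (hright j) (h.pos_right j).le
      _ = R' / R * W + ⟪∑ j, mu j • z j, d' - (R' / R) • d⟫ := by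
          rw [hW]
          simp only [sum_inner, real_inner_smul_left, Finset.mul_sum, ← Finset.sum_add_distrib]
          exact Finset.sum_congr rfl fun i _ => by ring
      _ = R' / R * W := by rw [h.sum_right_eq_zero, inner_zero_left, add_zero]
  rw [h.sum_inner_map_eq] at h1
  have h3 : r' / r ≤ R' / R := le_of_mul_le_mul_right (h1.trans h2) hW0
  rw [div_le_div_iff₀ hr hR] at h3
  rw [div_le_div_iff₀ hr hr']
  linarith

end Ader

/-! ### Improving a chain by a perturbation of the identity -/

section Perturb
variable {n : ℕ}
local notation "⟪" x ", " y "⟫" => inner ℝ x y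

/-- If a quadratic function with symmetric part `S` is positive at the inner contact points and one
with the same `S` is negative at the outer ones, then for `T = id + ε S` with small `ε > 0` the
ellipsoid `T(B) + ε v` contains a dilate of `r L₁ + c` by a factor `> 1`, while `T(B) + ε w` still
lies in `R L₂ + d`. Inclusions are compared through support functions: `‖T u‖ ≥ 1 + ε ⟪u, S u⟫` is
used for the inner one, and `‖T u‖ ≤ (1 + ‖T u‖²) / 2` for the outer one. -/
theorem exists_ellipsoid_chain_of_quadratic_separation {L₁ L₂ : Set (EuclideanSpace ℝ (Fin n))}
    {c d : EuclideanSpace ℝ (Fin n)} {r R : ℝ} (hr : 0 < r)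
    (hP : IsCompact (r • L₁ + {c})) (hQ : IsCompact (R • L₂ + {d}))
    (hQconv : Convex ℝ (R • L₂ + {d}))
    (hchain : IsContainmentChain L₁ (Metric.closedBall 0 1) L₂ r c R d)
    {S : EuclideanSpace ℝ (Fin n) →ₗ[ℝ] EuclideanSpace ℝ (Fin n)} (hS : S.IsSymmetric)
    (v w : EuclideanSpace ℝ (Fin n))
    (hY : ∀ u, ‖u‖ = 1 → u ∈ r • L₁ + {c} → 0 < ⟪u, S u + v⟫)
    (hZ : ∀ u, ‖u‖ = 1 → (∀ q ∈ R • L₂ + {d}, ⟪u, q⟫ ≤ 1) → ⟪u, S u + w⟫ < 0) :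
    ∃ (T : EuclideanSpace ℝ (Fin n) →ₗ[ℝ] EuclideanSpace ℝ (Fin n))
      (c' d' : EuclideanSpace ℝ (Fin n)) (r' : ℝ), r < r' ∧
      IsContainmentChain L₁ (T '' Metric.closedBall 0 1) L₂ r' c' R d' := by
  obtain ⟨hin, hout⟩ := hchain
  set P := r • L₁ + {c}
  set Q := R • L₂ + {d}
  have hSc : Continuous S := S.continuous_of_finiteDimensional
  have hQne : Q.Nonempty := ⟨0, hout (by simp)⟩
  have hsphere := isCompact_sphere (0 : EuclideanSpace ℝ (Fin n)) 1
  -- The support function of `Q`.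
  set hs : EuclideanSpace ℝ (Fin n) → ℝ := fun u => sSup ((fun q => ⟪u, q⟫) '' Q)
  have hsc : Continuous hs := hQ.continuous_sSup (by fun_prop)
  have hs_le : ∀ u, ∀ q ∈ Q, ⟪u, q⟫ ≤ hs u := fun u q hq =>
    le_csSup (hQ.image (by fun_prop)).bddAbove ⟨q, hq, rfl⟩
  have hs_att : ∀ u, ∃ q ∈ Q, ⟪u, q⟫ = hs u := fun u =>
    (hQ.image (f := fun q => ⟪u, q⟫) (by fun_prop)).sSup_mem (hQne.image _)
  have hself : ∀ u : EuclideanSpace ℝ (Fin n), ‖u‖ = 1 → ⟪u, u⟫ = 1 := fun u hu => by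
    rw [real_inner_self_eq_norm_sq, hu, one_pow]
  obtain ⟨η₁, hη₁, ε₁, hε₁, H₁⟩ := (hP.prod hsphere).exists_forall_mul_le_add_mul
    (F := fun p => 1 - ⟪p.2, p.1⟫) (G := fun p => ⟪p.2, S p.2 + v⟫)
    (by fun_prop) (by fun_prop)
    (by
      rintro ⟨x, u⟩ ⟨hx, hu⟩
      rw [mem_sphere_zero_iff_norm] at hu
      have hx' := mem_closedBall_zero_iff.1 (hin hx)
      have := real_inner_le_norm u x
      simp only at hu hx' ⊢
      rw [hu, one_mul] at this
      linarith)
    (by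
      rintro ⟨x, u⟩ ⟨hx, hu⟩ h0
      rw [mem_sphere_zero_iff_norm] at hu
      have hx' := mem_closedBall_zero_iff.1 (hin hx)
      simp only at hu hx' h0 hx ⊢
      -- Equality in Cauchy–Schwarz forces `x = u`.
      have h1 : ‖u - x‖ ^ 2 ≤ 0 := by
        rw [norm_sub_sq_real, hu]
        nlinarith [norm_nonneg x]
      have h2 : u - x = 0 := norm_eq_zero.1 (pow_eq_zero_iff two_ne_zero |>.1
        (le_antisymm h1 (sq_nonneg _)))
      rw [← sub_eq_zero.1 h2] at hx
      exact hY u hu hx)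
  obtain ⟨η₂, hη₂, ε₂, hε₂, H₂⟩ := hsphere.exists_forall_mul_le_add_mul
    (F := fun u => hs u - 1) (G := fun u => -⟪u, S u + w⟫)
    (by fun_prop) (by fun_prop)
    (by
      intro u hu
      rw [mem_sphere_zero_iff_norm] at hu
      have := hs_le u u (hout (mem_closedBall_zero_iff.2 hu.le))
      rw [hself u hu] at this
      linarith)
    (by
      intro u hu h0
      rw [mem_sphere_zero_iff_norm] at hu
      have := hZ u hu fun q hq => (hs_le u q hq).trans (by linarith)
      linarith)
  -- `C` controls the second-order term of `‖T u‖ ^ 2`; the last bound on `ε` absorbs it into `η₂`.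
  obtain ⟨C, hC⟩ := (hsphere.image (f := fun u => ‖S u‖ ^ 2) (by fun_prop)).bddAbove
  set ε := min (min ε₁ ε₂) (2 * η₂ / (|C| + 1))
  have hε : 0 < ε := by positivity
  have hε1 : ε ≤ ε₁ := (min_le_left _ _).trans (min_le_left _ _)
  have hε2 : ε ≤ ε₂ := (min_le_left _ _).trans (min_le_right _ _)
  have hε3 : ε * (|C| + 1) ≤ 2 * η₂ := (le_div_iff₀ (by positivity)).1 (min_le_right _ _)
  set T : EuclideanSpace ℝ (Fin n) →ₗ[ℝ] EuclideanSpace ℝ (Fin n) := LinearMap.id + ε • S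
  have hT : ∀ x, T x = x + ε • S x := fun x => rfl
  have hTsym : T.IsSymmetric := fun x y => by
    simp only [hT, inner_add_left, inner_add_right, real_inner_smul_left, real_inner_smul_right,
      hS x y]
  have hTadj : T.adjoint = T := (LinearMap.isSymmetric_iff_isSelfAdjoint T).1 hTsym
  set δ := ε * η₁
  have hδ0 : 0 < δ := by positivity
  refine ⟨T, (1 + δ) • c - ε • v, d - ε • w, (1 + δ) * r, by nlinarith, ?_, ?_⟩
  · intro p hp
    obtain ⟨l, hl, rfl⟩ := Set.mem_smul_set_add_singleton.1 hp
    have hxP : r • l + c ∈ P := Set.mem_smul_set_add_singleton.2 ⟨l, hl, rfl⟩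
    set x := r • l + c with hx
    have hrw : ((1 + δ) * r) • l + ((1 + δ) • c - ε • v) = (1 + δ) • x - ε • v := by
      rw [hx, smul_add, smul_smul]; abel
    rw [hrw]
    refine mem_image_closedBall_of_forall_inner_le T fun u hu => ?_
    rw [hTadj]
    have h1 := H₁ ε hε hε1 (x, u) ⟨hxP, mem_sphere_zero_iff_norm.2 hu⟩
    have hxn := mem_closedBall_zero_iff.1 (hin hxP)
    have h2 := real_inner_le_norm u x
    rw [hu, one_mul] at h2
    have h3 := real_inner_le_norm u (T u)
    rw [hu, one_mul, hT, inner_add_right, hself u hu, real_inner_smul_right] at h3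
    rw [hT]
    rw [inner_sub_right, real_inner_smul_right, real_inner_smul_right]
    simp only [inner_add_right] at h1
    nlinarith
  · rintro _ ⟨b, hb, rfl⟩
    rw [mem_closedBall_zero_iff] at hb
    have hmem : T b + ε • w ∈ Q := by
      refine hQconv.mem_of_forall_inner_le hQ.isClosed hQne fun u hu => ?_
      obtain ⟨q, hq, hqs⟩ := hs_att u
      refine ⟨q, hq, ?_⟩
      rw [hqs, inner_add_right, ← hTsym, real_inner_smul_right]
      have h1 := H₂ ε hε hε2 u (mem_sphere_zero_iff_norm.2 hu)
      have h2 : ⟪T u, b⟫ ≤ ‖T u‖ := (real_inner_le_norm _ _).trans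
        (mul_le_of_le_one_right (norm_nonneg _) hb)
      have h3 : ‖T u‖ ^ 2 = 1 + 2 * (ε * ⟪u, S u⟫) + ε ^ 2 * ‖S u‖ ^ 2 := by
        rw [hT, norm_add_sq_real, hu, real_inner_smul_right, norm_smul, Real.norm_eq_abs,
          mul_pow, sq_abs]
        ring
      have h4 : ‖S u‖ ^ 2 ≤ |C| + 1 :=
        (hC ⟨u, mem_sphere_zero_iff_norm.2 hu, rfl⟩).trans (by linarith [le_abs_self C])
      have h5 : ε ^ 2 * ‖S u‖ ^ 2 ≤ ε * (2 * η₂) := by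
        calc ε ^ 2 * ‖S u‖ ^ 2 ≤ ε ^ 2 * (|C| + 1) := by gcongr
          _ = ε * (ε * (|C| + 1)) := by ring
          _ ≤ _ := by gcongr
      simp only [inner_add_right] at h1
      nlinarith [sq_nonneg (‖T u‖ - 1)]
    obtain ⟨l, hl, hyl⟩ := Set.mem_smul_set_add_singleton.1 hmem
    refine Set.mem_smul_set_add_singleton.2 ⟨l, hl, ?_⟩
    rw [← add_sub_assoc, hyl, add_sub_cancel_right]

end Perturb

/-! ### Existence of short decompositions -/

section Moment
variable {n : ℕ}
local notation "⟪" x ", " y "⟫" => inner ℝ x y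

/-- The symmetrized product `(x yᵀ + y xᵀ) / 2`, stored as a function on unordered pairs of indices
so that the ambient space has dimension `n (n + 1) / 2`. -/
noncomputable def symmProd (x y : EuclideanSpace ℝ (Fin n)) : Sym2 (Fin n) → ℝ :=
  Sym2.lift ⟨fun i j => (x i * y j + x j * y i) / 2, fun i j => by ring⟩

@[simp] theorem symmProd_mk (x y : EuclideanSpace ℝ (Fin n)) (i j : Fin n) :
    symmProd x y s(i, j) = (x i * y j + x j * y i) / 2 := rfl

theorem symmProd_comm (x y : EuclideanSpace ℝ (Fin n)) : symmProd x y = symmProd y x := by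
  ext s
  induction s with | _ i j => simp only [symmProd_mk]; ring

theorem continuous_symmProd_self :
    Continuous fun x : EuclideanSpace ℝ (Fin n) => symmProd x x := by
  refine continuous_pi fun s => ?_
  induction s with | _ i j => simp only [symmProd_mk]; fun_prop

theorem symmProd_self_eq_sum (x : EuclideanSpace ℝ (Fin n)) :
    symmProd x x = ∑ i, ∑ j, (x i * x j) •
      symmProd (EuclideanSpace.single i 1) (EuclideanSpace.single j 1) := by
  ext s
  induction s with | _ k l =>
  simp only [Finset.sum_apply, Pi.smul_apply, symmProd_mk, smul_eq_mul, PiLp.single_apply,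
    add_div, mul_add, Finset.sum_add_distrib]
  simp only [mul_ite, mul_one, mul_zero, ite_div, zero_div, Finset.sum_ite_eq,
    Finset.mem_univ, if_true]
  ring

/-- Linear functionals on symmetric tensors are the quadratic forms of symmetric matrices. -/
theorem exists_isSymm_inner_eq (f : (Sym2 (Fin n) → ℝ) →ₗ[ℝ] ℝ) :
    ∃ A : Matrix (Fin n) (Fin n) ℝ, A.IsSymm ∧
      ∀ x, ⟪x, A.toEuclideanLin x⟫ = f (symmProd x x) := by
  refine ⟨.of fun i j => f (symmProd (EuclideanSpace.single i 1) (EuclideanSpace.single j 1)),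
    ?_, fun x => ?_⟩
  · ext i j
    simp [symmProd_comm]
  · rw [symmProd_self_eq_sum]
    simp only [map_sum, map_smul, smul_eq_mul, PiLp.inner_apply, Matrix.toLpLin_apply,
      Matrix.mulVec, dotProduct, Matrix.of_apply, RCLike.inner_apply, conj_trivial,
      Finset.sum_mul]
    exact Finset.sum_congr rfl fun i _ => Finset.sum_congr rfl fun j _ => by ring

/-- The space of triples (symmetric tensor, vector, vector), in which a centered decomposition is a
convex combination equal to zero. -/
abbrev MomentSpace (n : ℕ) : Type :=
  (Sym2 (Fin n) → ℝ) × EuclideanSpace ℝ (Fin n) × EuclideanSpace ℝ (Fin n)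

theorem finrank_momentSpace : (Module.finrank ℝ (MomentSpace n) : ℝ) = n * (n + 5) / 2 := by
  rw [Module.finrank_prod, Module.finrank_prod, Module.finrank_fintype_fun_eq_card, Sym2.card,
    finrank_euclideanSpace, Fintype.card_fin]
  push_cast [Nat.cast_choose_two]
  ring

/-- The Riesz representation of a linear functional on `ℝⁿ`. -/
theorem exists_inner_eq (f : EuclideanSpace ℝ (Fin n) →ₗ[ℝ] ℝ) :
    ∃ v, ∀ x, f x = ⟪x, v⟫ := by
  obtain ⟨v, hv⟩ := (InnerProductSpace.toDual ℝ _).surjective f.toContinuousLinearMap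
  refine ⟨v, fun x => ?_⟩
  rw [real_inner_comm, ← InnerProductSpace.toDual_apply_apply (𝕜 := ℝ), hv]
  rfl

/-- A functional separating `0` from the hull would consist of a symmetric matrix `A` and vectors
`v`, `w` violating the hypothesis. -/
theorem zero_mem_convexHull_moments {Y Z : Set (EuclideanSpace ℝ (Fin n))}
    (hY : IsCompact Y) (hZ : IsCompact Z)
    (h : ∀ A : Matrix (Fin n) (Fin n) ℝ, A.IsSymm → ∀ v w : EuclideanSpace ℝ (Fin n),
        ∃ y ∈ Y, ∃ z ∈ Z,
          ⟪y, A.toEuclideanLin y + v⟫ ≤ ⟪z, A.toEuclideanLin z + w⟫) :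
    (0 : MomentSpace n) ∈ convexHull ℝ
      ((fun y => ((symmProd y y, y, 0) : MomentSpace n)) '' Y ∪
        (fun z => ((-symmProd z z, 0, -z) : MomentSpace n)) '' Z) := by
  by_contra h0
  have hcont := continuous_symmProd_self (n := n)
  have hK : IsCompact ((fun y => ((symmProd y y, y, 0) : MomentSpace n)) '' Y ∪
        (fun z => ((-symmProd z z, 0, -z) : MomentSpace n)) '' Z) :=
    (hY.image (by fun_prop)).union (hZ.image (by fun_prop))
  obtain ⟨f, b, hb, hf⟩ := geometric_hahn_banach_point_closed (convex_convexHull ℝ _)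
    hK.convexHull_of_finiteDimensional.isClosed h0
  rw [map_zero] at hb
  obtain ⟨A, hA, hAf⟩ := exists_isSymm_inner_eq (f.toLinearMap ∘ₗ LinearMap.inl ℝ _ _)
  obtain ⟨v, hv⟩ := exists_inner_eq
    (f.toLinearMap ∘ₗ LinearMap.inr ℝ (Sym2 (Fin n) → ℝ) _ ∘ₗ LinearMap.inl ℝ _ _)
  obtain ⟨w, hw⟩ := exists_inner_eq
    (f.toLinearMap ∘ₗ LinearMap.inr ℝ (Sym2 (Fin n) → ℝ) _ ∘ₗ LinearMap.inr ℝ _ _)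
  simp only [LinearMap.coe_comp, Function.comp_apply, ContinuousLinearMap.coe_coe,
    LinearMap.inl_apply, LinearMap.inr_apply] at hAf hv hw
  obtain ⟨y, hy, z, hz, hle⟩ := h A hA v w
  have h1 := hf _ (subset_convexHull ℝ _ (Or.inl ⟨y, hy, rfl⟩))
  have h2 := hf _ (subset_convexHull ℝ _ (Or.inr ⟨z, hz, rfl⟩))
  have e1 : ((symmProd y y, y, 0) : MomentSpace n) = (symmProd y y, 0) + (0, y, 0) := by simp
  have e2 : ((-symmProd z z, 0, -z) : MomentSpace n) = -((symmProd z z, 0) + (0, 0, z)) := by simp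
  simp only at h1 h2
  rw [e1, map_add, ← hAf, hv, ← inner_add_right] at h1
  rw [e2, map_neg, map_add, ← hAf, hw, ← inner_add_right] at h2
  linarith

/-- A decomposition indexed by finite types, transported to `Fin N` and `Fin M`. -/
theorem IsAderDecomposition.of_fintype {Y Z : Set (EuclideanSpace ℝ (Fin n))}
    {I J : Type*} [Fintype I] [Fintype J] (hI : 1 ≤ Fintype.card I) (hJ : 1 ≤ Fintype.card J)
    {y : I → EuclideanSpace ℝ (Fin n)} {z : J → EuclideanSpace ℝ (Fin n)}
    {a : I → ℝ} {b : J → ℝ} (hy : ∀ i, y i ∈ Y) (hz : ∀ j, z j ∈ Z)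
    (ha : ∀ i, 0 < a i) (hb : ∀ j, 0 < b j)
    (h : ∀ x, ∑ i, (a i * ⟪x, y i⟫) • y i = ∑ j, (b j * ⟪x, z j⟫) • z j)
    (hyc : ∑ i, a i • y i = 0) (hzc : ∑ j, b j • z j = 0) :
    IsAderDecomposition Y Z (y ∘ (Fintype.equivFin I).symm) (a ∘ (Fintype.equivFin I).symm)
      (z ∘ (Fintype.equivFin J).symm) (b ∘ (Fintype.equivFin J).symm) where
  one_le_left := hI
  one_le_right := hJ
  mem_left _ := hy _
  mem_right _ := hz _
  pos_left _ := ha _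
  pos_right _ := hb _
  sum_inner_smul_eq x :=
    ((Fintype.equivFin I).symm.sum_comp fun i => (a i * ⟪x, y i⟫) • y i).trans <|
      (h x).trans ((Fintype.equivFin J).symm.sum_comp fun j => (b j * ⟪x, z j⟫) • z j).symm
  sum_left_eq_zero := ((Fintype.equivFin I).symm.sum_comp fun i => a i • y i).trans hyc
  sum_right_eq_zero := ((Fintype.equivFin J).symm.sum_comp fun j => b j • z j).trans hzc

/-- The bound on the number of points is Carathéodory's, in dimension `n (n + 5) / 2`; the trace
shows that both kinds of points occur. -/
theorem exists_isAderDecomposition_of_zero_mem_convexHull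
    {Y Z : Set (EuclideanSpace ℝ (Fin n))}
    (hY : ∀ y ∈ Y, ‖y‖ = 1) (hZ : ∀ z ∈ Z, ‖z‖ = 1)
    (h : (0 : MomentSpace n) ∈ convexHull ℝ
      ((fun y => ((symmProd y y, y, 0) : MomentSpace n)) '' Y ∪
        (fun z => ((-symmProd z z, 0, -z) : MomentSpace n)) '' Z)) :
    ∃ (N M : ℕ) (y : Fin N → EuclideanSpace ℝ (Fin n)) (lam : Fin N → ℝ)
        (z : Fin M → EuclideanSpace ℝ (Fin n)) (mu : Fin M → ℝ),
        IsAderDecomposition Y Z y lam z mu ∧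
          ((N + M : ℕ) : ℝ) ≤ (n : ℝ) * (n + 5) / 2 + 1 := by
  classical
  obtain ⟨ι, _, p, a, hp, hind, ha, ha1, hsum⟩ := eq_pos_convex_span_of_mem_convexHull h
  have hcard : (Fintype.card ι : ℝ) ≤ (n : ℝ) * (n + 5) / 2 + 1 := by
    rw [← finrank_momentSpace]
    exact_mod_cast hind.card_le_finrank_succ.trans (Nat.succ_le_succ (Submodule.finrank_le _))
  -- Split the index type according to which of the two sets the point comes from.
  let I := {i : ι // ∃ y ∈ Y, ((symmProd y y, y, 0) : MomentSpace n) = p i}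
  let J := {i : ι // ¬ ∃ y ∈ Y, ((symmProd y y, y, 0) : MomentSpace n) = p i}
  have hI : ∀ i : I, ∃ y ∈ Y, ((symmProd y y, y, 0) : MomentSpace n) = p i := fun i => i.2
  have hJ : ∀ j : J, ∃ z ∈ Z, ((-symmProd z z, 0, -z) : MomentSpace n) = p j := fun j =>
    (hp ⟨j.1, rfl⟩).resolve_left j.2
  choose y hyY hy using hI
  choose z hzZ hz using hJ
  have hsplit : ∑ i : I, a i • ((symmProd (y i) (y i), y i, 0) : MomentSpace n) +
      ∑ j : J, a j • ((-symmProd (z j) (z j), 0, -z j) : MomentSpace n) = 0 := by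
    rw [← hsum, ← Fintype.sum_subtype_add_sum_subtype
      (fun i => ∃ y ∈ Y, ((symmProd y y, y, 0) : MomentSpace n) = p i) (fun i => a i • p i)]
    simp only [hy, hz]
    rfl
  have hsplit1 : ∑ i : I, a i + ∑ j : J, a j = 1 := by
    rw [← ha1]
    exact Fintype.sum_subtype_add_sum_subtype _ a
  have hmat : ∀ k l : Fin n, ∑ i : I, a i * (y i k * y i l) = ∑ j : J, a j * (z j k * z j l) := by
    intro k l
    have := congr_fun (congr_arg Prod.fst hsplit) s(k, l)
    simp only [Prod.fst_add, Prod.fst_sum, Prod.smul_fst, Pi.add_apply, Finset.sum_apply,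
      Pi.smul_apply, Pi.neg_apply, symmProd_mk, smul_eq_mul, Prod.fst_zero, Pi.zero_apply,
      mul_neg, Finset.sum_neg_distrib] at this
    have h2 := add_neg_eq_zero.1 this
    refine (Finset.sum_congr rfl fun i _ => ?_).trans
      (h2.trans (Finset.sum_congr rfl fun i _ => ?_)) <;> ring
  have hyc : ∑ i : I, a i • y i = 0 := by
    simpa [Prod.fst_sum, Prod.snd_sum] using congr_arg (fun q => q.2.1) hsplit
  have hzc : ∑ j : J, a j • z j = 0 := by
    simpa [Prod.fst_sum, Prod.snd_sum] using congr_arg (fun q => q.2.2) hsplit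
  -- The trace of the matrix identity shows that both families carry the same total weight.
  have hnorm : ∀ x : EuclideanSpace ℝ (Fin n), ‖x‖ = 1 → ∑ k, x k * x k = 1 := fun x hx => by
    have := EuclideanSpace.real_norm_sq_eq x
    rw [hx] at this
    simpa [sq] using this.symm
  have htr : ∑ i : I, a i = ∑ j : J, a j := by
    have := Finset.sum_congr (rfl : (Finset.univ : Finset (Fin n)) = _) fun k _ => hmat k k
    rw [Finset.sum_comm, Finset.sum_comm (s := (Finset.univ : Finset (Fin n)))] at this
    simpa only [← Finset.mul_sum, hnorm _ (hY _ (hyY _)), hnorm _ (hZ _ (hzZ _)), mul_one]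
      using this
  have hIpos : 1 ≤ Fintype.card I := Fintype.card_pos_iff.2 <| by
    by_contra hne
    rw [not_nonempty_iff] at hne
    simp [← htr] at hsplit1
  have hJpos : 1 ≤ Fintype.card J := Fintype.card_pos_iff.2 <| by
    by_contra hne
    rw [not_nonempty_iff] at hne
    simp [htr] at hsplit1
  refine ⟨_, _, _, _, _, _, IsAderDecomposition.of_fintype hIpos hJpos hyY hzZ
    (fun i => ha i) (fun j => ha j) (fun x => ?_) hyc hzc, ?_⟩
  · ext k
    simp only [WithLp.ofLp_sum, Finset.sum_apply, PiLp.smul_apply, smul_eq_mul,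
      PiLp.inner_apply, RCLike.inner_apply, conj_trivial, Finset.mul_sum, Finset.sum_mul]
    rw [Finset.sum_comm, Finset.sum_comm (γ := J)]
    refine Finset.sum_congr rfl fun l _ => ?_
    have := congr_arg (x l * ·) (hmat l k)
    simp only [Finset.mul_sum] at this
    refine (Finset.sum_congr rfl fun i _ => ?_).trans
      (this.trans (Finset.sum_congr rfl fun i _ => ?_)) <;> ring
  · have : Fintype.card I + Fintype.card J = Fintype.card ι := by
      rw [← Fintype.card_sum]
      exact Fintype.card_congr (Equiv.sumCompl _)
    rwa [this]

end Moment

/-! ### Equivalence of the conditions -/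

/-- No quadratic function can be strictly larger on the inner contact points than another one with
the same quadratic part on the outer contact points: after a shift of `S` by a multiple of the
identity the values would have opposite signs, and `id + ε S` would improve the chain. -/
theorem IsAffinelyOptimal.exists_inner_le {n : ℕ} {L₁ L₂ : Set (EuclideanSpace ℝ (Fin n))}
    {c d : EuclideanSpace ℝ (Fin n)} {r R : ℝ} (hr : 0 < r) (hR : 0 < R)
    (hP : IsCompact (r • L₁ + {c})) (hQ : IsCompact (R • L₂ + {d}))
    (hQconv : Convex ℝ (R • L₂ + {d}))
    (hopt : IsAffinelyOptimal L₁ (Metric.closedBall 0 1) L₂ r c R d)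
    {S : EuclideanSpace ℝ (Fin n) →ₗ[ℝ] EuclideanSpace ℝ (Fin n)} (hS : S.IsSymmetric)
    (v w : EuclideanSpace ℝ (Fin n)) :
    ∃ y ∈ contactPoints (Metric.closedBall 0 1) (r • L₁ + {c}),
      ∃ z ∈ contactPoints (Metric.closedBall 0 1) (R • L₂ + {d}),
        inner ℝ y (S y + v) ≤ inner ℝ z (S z + w) := by
  by_contra! hlt
  have hSc : Continuous S := S.continuous_of_finiteDimensional
  -- Compactness yields a level `a` strictly between the two families of values.
  obtain ⟨a, haY, haZ⟩ := (isCompact_contactPoints_closedBall _).exists_forall_between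
    (isCompact_contactPoints_closedBall _) (f := fun y => inner ℝ y (S y + v))
    (g := fun z => inner ℝ z (S z + w)) (by fun_prop) (by fun_prop) hlt
  -- On the unit sphere, subtracting `a • id` from `S` shifts both functions by `-a`.
  let S' : EuclideanSpace ℝ (Fin n) →ₗ[ℝ] EuclideanSpace ℝ (Fin n) := S - a • LinearMap.id
  have hS'_apply : ∀ u, S' u = S u - a • u := fun _ => rfl
  have hshift : ∀ u x : EuclideanSpace ℝ (Fin n), ‖u‖ = 1 →
      inner ℝ u (S' u + x) = inner ℝ u (S u + x) - a := by
    intro u x hu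
    simp only [hS'_apply, inner_add_right, inner_sub_right, real_inner_smul_right,
      real_inner_self_eq_norm_sq, hu]
    ring
  have hS' : S'.IsSymmetric := fun x y => by
    simp only [hS'_apply, inner_sub_left, inner_sub_right, real_inner_smul_left,
      real_inner_smul_right, hS x y]
  obtain ⟨T, c', d', r', hr', hchain⟩ := exists_ellipsoid_chain_of_quadratic_separation hr hP hQ
    hQconv hopt.1 hS' v w
    (fun u hu huP => by
      rw [hshift u v hu, sub_pos]
      exact haY u ((mem_contactPoints_of_subset_closedBall hP.isClosed hopt.1.1).2 ⟨hu, huP⟩))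
    (fun u hu huQ => by
      rw [hshift u w hu, sub_neg]
      exact haZ u
        ((mem_contactPoints_of_closedBall_subset hQconv hQ.isClosed hopt.1.2).2 ⟨hu, huQ⟩))
  exact absurd (hopt.2 T c' d' r' R (hr.trans hr') hR hchain)
    (not_le.2 (div_lt_div_of_pos_left hR hr hr'))

theorem mainTheorem2 {n : ℕ} (L₁ L₂ : ConvexBody (EuclideanSpace ℝ (Fin n)))
    (hL₁ : (interior (L₁ : Set (EuclideanSpace ℝ (Fin n)))).Nonempty)
    (hL₂ : (interior (L₂ : Set (EuclideanSpace ℝ (Fin n)))).Nonempty)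
    (c d : EuclideanSpace ℝ (Fin n)) (r R : ℝ) (hr : 0 < r) (hR : 0 < R)
    (B Y Z : Set (EuclideanSpace ℝ (Fin n)))
    (hB : B = Metric.closedBall (0 : EuclideanSpace ℝ (Fin n)) 1)
    (hY : Y = contactPoints B (r • (L₁ : Set (EuclideanSpace ℝ (Fin n))) + {c}))
    (hZ : Z = contactPoints B (R • (L₂ : Set (EuclideanSpace ℝ (Fin n))) + {d}))
    (hchain : IsContainmentChain (L₁ : Set (EuclideanSpace ℝ (Fin n))) B
      (L₂ : Set (EuclideanSpace ℝ (Fin n))) r c R d) :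
    -- equivalence of the three conditions
    List.TFAE [
      IsAffinelyOptimal (L₁ : Set (EuclideanSpace ℝ (Fin n))) B
        (L₂ : Set (EuclideanSpace ℝ (Fin n))) r c R d,
      ∀ A : Matrix (Fin n) (Fin n) ℝ, A.IsSymm → ∀ v w : EuclideanSpace ℝ (Fin n),
        ∃ y ∈ Y, ∃ z ∈ Z,
          inner ℝ y (A.toEuclideanLin y + v) ≤ inner ℝ z (A.toEuclideanLin z + w),
      ∃ (N M : ℕ) (y : Fin N → EuclideanSpace ℝ (Fin n)) (lam : Fin N → ℝ)
        (z : Fin M → EuclideanSpace ℝ (Fin n)) (mu : Fin M → ℝ),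
        IsAderDecomposition Y Z y lam z mu] ∧
    -- every decomposition as in the third condition has equal total weights
    (∀ (N M : ℕ) (y : Fin N → EuclideanSpace ℝ (Fin n)) (lam : Fin N → ℝ)
        (z : Fin M → EuclideanSpace ℝ (Fin n)) (mu : Fin M → ℝ),
        IsAderDecomposition Y Z y lam z mu → ∑ i, lam i = ∑ j, mu j) ∧
    -- and if the chain is affinely-optimal, a decomposition with few points exists
    (IsAffinelyOptimal (L₁ : Set (EuclideanSpace ℝ (Fin n))) B
        (L₂ : Set (EuclideanSpace ℝ (Fin n))) r c R d →
      ∃ (N M : ℕ) (y : Fin N → EuclideanSpace ℝ (Fin n)) (lam : Fin N → ℝ)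
        (z : Fin M → EuclideanSpace ℝ (Fin n)) (mu : Fin M → ℝ),
        IsAderDecomposition Y Z y lam z mu ∧
          ((N + M : ℕ) : ℝ) ≤ (n : ℝ) * (n + 5) / 2 + 1) := by

  subst hB
  have hP : IsCompact (r • (L₁ : Set (EuclideanSpace ℝ (Fin n))) + {c}) :=
    (L₁.isCompact.smul r).add isCompact_singleton
  have hQ : IsCompact (R • (L₂ : Set (EuclideanSpace ℝ (Fin n))) + {d}) :=
    (L₂.isCompact.smul R).add isCompact_singleton
  have hQconv : Convex ℝ (R • (L₂ : Set (EuclideanSpace ℝ (Fin n))) + {d}) :=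
    (L₂.convex.smul R).add (convex_singleton d)
  have hYmem : ∀ y ∈ Y, ‖y‖ = 1 ∧ y ∈ r • (L₁ : Set (EuclideanSpace ℝ (Fin n))) + {c} :=
    fun y hy => (mem_contactPoints_of_subset_closedBall hP.isClosed hchain.1).1 (hY ▸ hy)
  have hZmem : ∀ z ∈ Z, ‖z‖ = 1 ∧
      ∀ q ∈ R • (L₂ : Set (EuclideanSpace ℝ (Fin n))) + {d}, inner ℝ z q ≤ 1 :=
    fun z hz =>
      (mem_contactPoints_of_closedBall_subset hQconv hQ.isClosed hchain.2).1 (hZ ▸ hz)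
  have hYcpt : IsCompact Y := hY ▸ isCompact_contactPoints_closedBall _
  have hZcpt : IsCompact Z := hZ ▸ isCompact_contactPoints_closedBall _
  have h12 : IsAffinelyOptimal (L₁ : Set (EuclideanSpace ℝ (Fin n))) (Metric.closedBall 0 1)
        (L₂ : Set (EuclideanSpace ℝ (Fin n))) r c R d →
      ∀ A : Matrix (Fin n) (Fin n) ℝ, A.IsSymm → ∀ v w : EuclideanSpace ℝ (Fin n),
        ∃ y ∈ Y, ∃ z ∈ Z,
          inner ℝ y (A.toEuclideanLin y + v) ≤ inner ℝ z (A.toEuclideanLin z + w) := by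
    intro hopt A hA v w
    rw [hY, hZ]
    refine hopt.exists_inner_le hr hR hP hQ hQconv
      (Matrix.isSymmetric_toEuclideanLin_iff.2 ?_) v w
    rwa [Matrix.IsHermitian, Matrix.conjTranspose_eq_transpose_of_trivial]
  have h23 := fun h => exists_isAderDecomposition_of_zero_mem_convexHull
    (fun y hy => (hYmem y hy).1) (fun z hz => (hZmem z hz).1)
    (zero_mem_convexHull_moments hYcpt hZcpt h)
  refine ⟨?_, fun N M y lam z mu h => h.sum_eq_sum (fun y hy => (hYmem y hy).1)
    fun z hz => (hZmem z hz).1, fun h => h23 (h12 h)⟩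
  tfae_have 1 → 2 := h12
  tfae_have 2 → 3 := fun h => by
    obtain ⟨N, M, y, lam, z, mu, hdec, -⟩ := h23 h
    exact ⟨N, M, y, lam, z, mu, hdec⟩
  tfae_have 3 → 1 := by
    rintro ⟨N, M, y, lam, z, mu, hdec⟩
    exact hdec.isAffinelyOptimal hr hR hchain hYmem hZmem
  tfae_finish
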